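/- Let $m\ge 3$ and let $C_m$ be the cycle with vertex set $[m]=\{1,\dots,m\}$ and edges $\{1,2\},\{2,3\},\dots,\{m-1,m\},\{1,m\}$. Let $\Delta$ be the simplicial complex whose facets are the edges of $C_m$. For real parameters $\gamma=(\gamma_{i,F} : F\in\Delta,\ i\in F)$ let $\Gamma(\gamma)$ be the $[m]\times\Delta$ matrix with entries $\Gamma(\gamma)_{i,F}=\gamma_{i,F}$ if $i\in F$ and $\Gamma(\gamma)_{i,F}=0$ otherwise, and let $\phi_{C_m}(\gamma)=\Gamma(\gamma)\Gamma(\gamma)^T$. For a symmetric matrix $\Sigma$ let $\Sigma^{(12)}$ be the matrix obtained from $\Sigma$ by negating its $(1,2)$ and $(2,1)$ entries. Let $\Sigma\in\mathbb{R}^{m\times m}$ be a positive definite matrix in the image of $\phi_{C_m}$ such that $\Sigma^{(12)}$ is nonsingular. Then the fiber $$\{\gamma : \phi_{C_m}(\gamma)=\Sigma \text{ and } \gamma_{i,\{i\}}=0 \text{ for all } i=1,\dots,m\}$$ consists of exactly $2^{m+1}$ elements, and of exactly two elements up to sign: it falls into exactly two classes when parameters whose corresponding coordinates are all equal or opposite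 are identified. -/

import Mathlib

/-- The parameter space `∏_{F ∈ Δ} ℝ^{|F|}`: a parameter `γ` has one real coordinate
`γ_{i,F} = γ F i` for each `F ∈ Δ` and each `i ∈ F`. -/
abbrev FaceParams {m : ℕ} (Δ : Finset (Finset (Fin m))) : Type :=
  (F : {F : Finset (Fin m) // F ∈ Δ}) → {i : Fin m // i ∈ F.1} → ℝ

/-- The `[m] × Δ` matrix `Γ(γ)`. -/
def gammaMatrix {m : ℕ} (Δ : Finset (Finset (Fin m))) (γ : FaceParams Δ) :
    Matrix (Fin m) {F : Finset (Fin m) // F ∈ Δ} ℝ :=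
  Matrix.of fun i F => if h : i ∈ F.1 then γ F ⟨i, h⟩ else 0

/-- The parametrization `φ_Δ(γ) = Γ(γ) Γ(γ)ᵀ`. -/
def phi {m : ℕ} (Δ : Finset (Finset (Fin m))) (γ : FaceParams Δ) :
    Matrix (Fin m) (Fin m) ℝ :=
  gammaMatrix Δ γ * (gammaMatrix Δ γ).transpose

open Classical in
/-- The edge complex of a graph on `[m]`: its faces are the empty set, the vertices and
the edges. -/
noncomputable def edgeComplex {m : ℕ} (G : SimpleGraph (Fin m)) :
    Finset (Finset (Fin m)) :=
  Finset.univ.filter fun F => F.card ≤ 1 ∨ ∃ i j, G.Adj i j ∧ F = {i, j}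

/-- The simplicial complex whose facets are the edges of the chordless `m`-cycle
(used for `m ≥ 3`). -/
noncomputable def cycleComplex (m : ℕ) : Finset (Finset (Fin m)) :=
  edgeComplex (SimpleGraph.cycleGraph m)

theorem singleton_mem_cycleComplex {m : ℕ} (i : Fin m) : {i} ∈ cycleComplex m := by
  simp [cycleComplex, edgeComplex]

/-- The fiber of `φ_{C_m}` over `S` with all `γ_{i,{i}}` equal to zero. -/
def cycleFiber {m : ℕ} (S : Matrix (Fin m) (Fin m) ℝ) : Set (FaceParams (cycleComplex m)) :=
  {γ | phi (cycleComplex m) γ = S ∧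
    ∀ i : Fin m, γ ⟨{i}, singleton_mem_cycleComplex i⟩ ⟨i, Finset.mem_singleton_self i⟩ = 0}

/-- Two parameters agree up to sign: corresponding coordinates are equal or opposite. -/
def EqUpToSign {m : ℕ} {Δ : Finset (Finset (Fin m))} (γ γ' : FaceParams Δ) : Prop :=
  ∀ F i, γ F i = γ' F i ∨ γ F i = -γ' F i

/-- The matrix `S^{(kl)}` obtained from `S` by negating the entries `(k, l)` and `(l, k)`. -/
def negateEntry {m : ℕ} (S : Matrix (Fin m) (Fin m) ℝ) (k l : Fin m) :
    Matrix (Fin m) (Fin m) ℝ :=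
  Matrix.of fun i j => if (i = k ∧ j = l) ∨ (i = l ∧ j = k) then -S i j else S i j

/-! Write `a k`, `b k` for the two coordinates on the edge `{k, k+1}`. With vanishing vertex
coordinates the fiber is `a i ^ 2 + b (i-1) ^ 2 = s i`, `a i * b i = t i`. Putting `y i = b i ^ 2`
gives the cyclic system `(s i - y (i-1)) * y i = t i ^ 2`; write `x i = s i - y (i-1)`.

Nondegeneracy: det Σ · det Σ^(12) = (∏ x - ∏ y)² at every solution, so ∏ x ≠ ∏ y; positive
definiteness enters only through det Σ ≠ 0.

At least two solutions: relaxing `=` to `≥` gives a compact region, nonempty because Σ is in the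
image. Minimizers and maximizers of `∑ y` solve the system, and nondegeneracy allows a perturbation
to strict inequalities, so the two cannot coincide (`exists_two_cyclicSolutions`).

At most two: the inverse differences from a fixed solution satisfy a nonsingular affine system
(`cyclicSolutions_eq_or_eq`).

Each solution fixes every pair `(a k, b k)` up to a common sign, and no pair is zero, whence 2 · 2^m
points in two classes. -/

/-! ### Cyclic two-term linear recursions -/

open Fin.CommRing in
theorem Fin.cyclic_induction {n : ℕ} {P : Fin (n + 1) → Prop} (h : ∀ i, P i → P (i + 1))
    {i : Fin (n + 1)} (hi : P i) (j : Fin (n + 1)) : P j := by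
  have key : ∀ k : ℕ, P (i + (k : Fin (n + 1))) := by
    intro k
    induction k with
    | zero => simpa using hi
    | succ k ih => simpa [add_assoc] using h _ ih
  have := key (j - i).val
  simpa using this

theorem Fin.cyclic_induction_down {n : ℕ} {P : Fin (n + 1) → Prop} (h : ∀ i, P i → P (i - 1))
    {i : Fin (n + 1)} (hi : P i) (j : Fin (n + 1)) : P j := by
  by_contra hj
  exact Fin.cyclic_induction (P := fun k => ¬ P k)
    (fun k hk hk' => hk (by simpa using h _ hk')) hj i hi

/-- A solution of a homogeneous cyclic two-term recursion vanishes everywhere or nowhere. -/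
theorem cyclic_eq_zero_or_forall_ne_zero {n : ℕ} {x z d : Fin (n + 1) → ℝ}
    (h : ∀ i, x i * d i = z i * d (i - 1))
    (hz : ∀ i, d (i - 1) = 0 → x i = 0 → ∀ j, z j ≠ 0) :
    d = 0 ∨ ∀ i, d i ≠ 0 := by
  by_cases hall : ∀ i, d i ≠ 0
  · exact Or.inr hall
  left
  push Not at hall
  obtain ⟨i₀, hi₀⟩ := hall
  by_cases hup : ∀ i, d i = 0 → d (i + 1) = 0
  · exact funext (Fin.cyclic_induction hup hi₀)
  push Not at hup
  obtain ⟨i, hi, hi'⟩ := hup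
  have hx : x (i + 1) = 0 := by
    have := h (i + 1)
    simp only [add_sub_cancel_right, hi, mul_zero, mul_eq_zero, hi', or_false] at this
    exact this
  -- A zero followed by a nonzero forces a vanishing `x`; then no `z` vanishes, and the zero spreads
  -- backwards around the cycle.
  have hzj := hz (i + 1) (by simpa using hi) hx
  refine funext (Fin.cyclic_induction_down (P := fun k => d k = 0) (fun k hk => ?_) hi)
  have := h k
  rw [hk, mul_zero, eq_comm, mul_eq_zero] at this
  exact this.resolve_left (hzj k)

/-- If no `d i` vanishes, multiplying the equations around the cycle and cancelling `∏ d` gives `∏ x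
= ∏ y`. -/
theorem cyclic_eq_zero {n : ℕ} {x y d : Fin (n + 1) → ℝ} (hxy : ∏ i, x i ≠ ∏ i, y i)
    (h : ∀ i, x i * d i = y i * d (i - 1)) : d = 0 := by
  refine (cyclic_eq_zero_or_forall_ne_zero h ?_).resolve_right ?_
  · intro i _ hi j hj
    exact hxy (by rw [Finset.prod_eq_zero (Finset.mem_univ i) hi,
      Finset.prod_eq_zero (Finset.mem_univ j) hj])
  · intro hd
    have h1 : ∏ i, x i * d i = ∏ i, y i * d (i - 1) := Finset.prod_congr rfl fun i _ => h i
    have h2 : ∏ i, d (i - 1) = ∏ i, d i := (Equiv.subRight (1 : Fin (n + 1))).prod_comp d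
    rw [Finset.prod_mul_distrib, Finset.prod_mul_distrib, h2] at h1
    exact hxy (mul_right_cancel₀ (Finset.prod_ne_zero_iff.2 fun i _ => hd i) h1)

theorem exists_cyclic_eq_one {n : ℕ} {x y : Fin (n + 1) → ℝ} (hxy : ∏ i, x i ≠ ∏ i, y i) :
    ∃ d : Fin (n + 1) → ℝ, ∀ i, x i * d i - y i * d (i - 1) = 1 := by
  let f : (Fin (n + 1) → ℝ) →ₗ[ℝ] (Fin (n + 1) → ℝ) :=
    { toFun := fun d i => x i * d i - y i * d (i - 1)
      map_add' := fun d e => by ext i; simp only [Pi.add_apply]; ring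
      map_smul' := fun c d => by
        ext i; simp only [Pi.smul_apply, smul_eq_mul, RingHom.id_apply]; ring }
  have hinj : Function.Injective f := by
    rw [injective_iff_map_eq_zero]
    intro d hd
    exact cyclic_eq_zero hxy fun i => sub_eq_zero.1 (congrFun hd i)
  obtain ⟨d, hd⟩ := LinearMap.injective_iff_surjective.1 hinj (fun _ => 1)
  exact ⟨d, fun i => congrFun hd i⟩

/-! ### The cyclic quadratic system has exactly two solutions -/

/-- The region cut out by the inequalities `(s i - y (i - 1)) * y i ≥ r i`. -/
def cyclicFeasible {n : ℕ} (s r : Fin (n + 1) → ℝ) : Set (Fin (n + 1) → ℝ) :=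
  {y | ∀ i, 0 ≤ y i ∧ y (i - 1) ≤ s i ∧ r i ≤ (s i - y (i - 1)) * y i}

/-- The nonnegative solutions of the cyclic quadratic system `(s i - y (i - 1)) * y i = r i`. -/
def cyclicSolutions {n : ℕ} (s r : Fin (n + 1) → ℝ) : Set (Fin (n + 1) → ℝ) :=
  {y | ∀ i, 0 ≤ y i ∧ y (i - 1) ≤ s i ∧ (s i - y (i - 1)) * y i = r i}

theorem cyclicSolutions_subset {n : ℕ} (s r : Fin (n + 1) → ℝ) :
    cyclicSolutions s r ⊆ cyclicFeasible s r :=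
  fun _ hy i => ⟨(hy i).1, (hy i).2.1, (hy i).2.2.ge⟩

theorem isCompact_cyclicFeasible {n : ℕ} (s r : Fin (n + 1) → ℝ) :
    IsCompact (cyclicFeasible s r) := by
  have hsub : cyclicFeasible s r ⊆ Set.univ.pi fun i => Set.Icc 0 (s (i + 1)) := by
    intro y hy i _
    exact ⟨(hy i).1, by simpa using (hy (i + 1)).2.1⟩
  refine (isCompact_univ_pi fun i => isCompact_Icc).of_isClosed_subset ?_ hsub
  simp only [cyclicFeasible, Set.ofPred_forall, Set.ofPred_and]
  refine isClosed_iInter fun i => (isClosed_le ?_ ?_).inter ((isClosed_le ?_ ?_).inter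
    (isClosed_le ?_ ?_)) <;> fun_prop

theorem Fin.sub_one_ne_self {n : ℕ} (i : Fin (n + 2)) : i - 1 ≠ i := by
  simp [sub_eq_self]

/-- If constraint `i` is slack, lowering `y i` until it is tight only loosens constraint `i + 1` and
decreases the sum. -/
theorem mem_cyclicSolutions_of_isMinOn {n : ℕ} {s r y : Fin (n + 2) → ℝ} (hr : ∀ i, 0 ≤ r i)
    (hy : y ∈ cyclicFeasible s r)
    (hmin : ∀ z ∈ cyclicFeasible s r, ∑ i, y i ≤ ∑ i, z i) : y ∈ cyclicSolutions s r := by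
  intro i
  refine ⟨(hy i).1, (hy i).2.1, le_antisymm ?_ (hy i).2.2⟩
  by_contra! hlt
  have hx : 0 < s i - y (i - 1) := by
    refine lt_of_le_of_ne (sub_nonneg.2 (hy i).2.1) fun h => ?_
    rw [← h, zero_mul] at hlt
    exact absurd (hr i) (not_le.2 hlt)
  set v := r i / (s i - y (i - 1)) with hv
  have hvy : v < y i := by rw [hv, div_lt_iff₀ hx, mul_comm]; exact hlt
  have hv0 : 0 ≤ v := div_nonneg (hr i) hx.le
  have hle : ∀ k, Function.update y i v k ≤ y k := by
    intro k
    rcases eq_or_ne k i with rfl | hk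
    · simpa using hvy.le
    · simp [hk]
  have hfeas : Function.update y i v ∈ cyclicFeasible s r := by
    intro k
    have hk1 := hle (k - 1)
    rcases eq_or_ne k i with rfl | hk
    · refine ⟨by simpa using hv0, hk1.trans (hy k).2.1, ?_⟩
      rw [Function.update_of_ne (Fin.sub_one_ne_self k), Function.update_self, hv,
        mul_div_cancel₀ _ hx.ne']
    · rw [Function.update_of_ne hk]
      exact ⟨(hy k).1, hk1.trans (hy k).2.1, (hy k).2.2.trans
        (mul_le_mul_of_nonneg_right (by linarith) (hy k).1)⟩
  exact absurd (hmin _ hfeas) (not_le.2 (Finset.sum_lt_sum (fun k _ => hle k)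
    ⟨i, Finset.mem_univ i, by simpa using hvy⟩))

/-- Dually, a slack constraint `i` allows `y (i - 1)` to be raised, which only helps constraint `i -
1`. -/
theorem mem_cyclicSolutions_of_isMaxOn {n : ℕ} {s r y : Fin (n + 2) → ℝ} (hr : ∀ i, 0 ≤ r i)
    (hy : y ∈ cyclicFeasible s r)
    (hmax : ∀ z ∈ cyclicFeasible s r, ∑ i, z i ≤ ∑ i, y i) : y ∈ cyclicSolutions s r := by
  intro i
  refine ⟨(hy i).1, (hy i).2.1, le_antisymm ?_ (hy i).2.2⟩
  by_contra! hlt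
  have hyi : 0 < y i := by
    refine lt_of_le_of_ne (hy i).1 fun h => ?_
    rw [← h, mul_zero] at hlt
    exact absurd (hr i) (not_le.2 hlt)
  set v := s i - r i / y i with hv
  have hvy : y (i - 1) < v := by
    rw [hv, lt_sub_comm, div_lt_iff₀ hyi]; exact hlt
  have hle : ∀ k, y k ≤ Function.update y (i - 1) v k := by
    intro k
    rcases eq_or_ne k (i - 1) with rfl | hk
    · simpa using hvy.le
    · simp [hk]
  have hfeas : Function.update y (i - 1) v ∈ cyclicFeasible s r := by
    intro k
    have hk1 := hle k
    refine ⟨(hy k).1.trans hk1, ?_⟩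
    rcases eq_or_ne k i with rfl | hk
    · rw [Function.update_of_ne (Fin.sub_one_ne_self k).symm, Function.update_self, hv,
        sub_sub_cancel, div_mul_cancel₀ _ hyi.ne']
      exact ⟨sub_le_self _ (div_nonneg (hr k) hyi.le), le_rfl⟩
    · rw [Function.update_of_ne (a := k - 1) (fun h => hk (sub_left_injective h))]
      exact ⟨(hy k).2.1, (hy k).2.2.trans
        (mul_le_mul_of_nonneg_left hk1 (sub_nonneg.2 (hy k).2.1))⟩
  exact absurd (hmax _ hfeas) (not_le.2 (Finset.sum_lt_sum (fun k _ => hle k)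
    ⟨i - 1, Finset.mem_univ _, by simpa using hvy⟩))

open Filter Topology in
theorem eventually_nonneg_add_mul {p q : ℝ} (hp : 0 ≤ p) (h : p = 0 → 0 ≤ q) :
    ∀ᶠ ε in 𝓝[>] (0 : ℝ), 0 ≤ p + ε * q := by
  rcases hp.eq_or_lt with hp | hp
  · filter_upwards [self_mem_nhdsWithin] with ε hε
    rw [← hp, zero_add]
    exact mul_nonneg (le_of_lt hε) (h hp.symm)
  · have : Tendsto (fun ε : ℝ => p + ε * q) (𝓝[>] 0) (𝓝 (p + 0 * q)) :=
      tendsto_nhdsWithin_of_tendsto_nhds (Continuous.tendsto (by fun_prop) 0)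
    filter_upwards [this.eventually (lt_mem_nhds (by simpa using hp))] with ε hε using le_of_lt hε

-- Moving along `d` with `x i * d i - y i * d (i - 1) = 1` raises every product to first order. At a
-- boundary point, where `y i = 0` or `x i = 0`, the same equation makes `d` point inward.
open Filter Topology in
theorem exists_cyclicFeasible_strict {n : ℕ} {s r y : Fin (n + 1) → ℝ}
    (hy : y ∈ cyclicSolutions s r) (hxy : ∏ i, (s i - y (i - 1)) ≠ ∏ i, y i) :
    ∃ z ∈ cyclicFeasible s r, ∀ i, r i < (s i - z (i - 1)) * z i := by
  obtain ⟨d, hd⟩ := exists_cyclic_eq_one hxy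
  have h1 : ∀ᶠ ε in 𝓝[>] (0 : ℝ), ∀ i, 0 ≤ y i + ε * d i := by
    refine eventually_all.2 fun i => eventually_nonneg_add_mul (hy i).1 fun h => ?_
    have h2 := hd i
    rw [h, zero_mul, sub_zero] at h2
    exact (pos_of_mul_pos_right (h2 ▸ one_pos) (sub_nonneg.2 (hy i).2.1)).le
  have h2 : ∀ᶠ ε in 𝓝[>] (0 : ℝ), ∀ i, 0 ≤ (s i - y (i - 1)) + ε * (-d (i - 1)) := by
    refine eventually_all.2 fun i =>
      eventually_nonneg_add_mul (sub_nonneg.2 (hy i).2.1) fun h => ?_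
    have h2 := hd i
    rw [h, zero_mul, zero_sub, ← mul_neg] at h2
    exact (pos_of_mul_pos_right (h2 ▸ one_pos) (hy i).1).le
  have h3 : ∀ᶠ ε in 𝓝[>] (0 : ℝ), ∀ i, ε * (d i * d (i - 1)) < 1 := by
    refine eventually_all.2 fun i => ?_
    have : Tendsto (fun ε : ℝ => ε * (d i * d (i - 1))) (𝓝[>] 0) (𝓝 (0 * (d i * d (i - 1)))) :=
      tendsto_nhdsWithin_of_tendsto_nhds (Continuous.tendsto (by fun_prop) 0)
    exact this.eventually (gt_mem_nhds (by simp))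
  obtain ⟨ε, ⟨⟨h1, h2⟩, h3⟩, hε⟩ := (((h1.and h2).and h3).and self_mem_nhdsWithin).exists
  have hε : 0 < ε := hε
  have key : ∀ i, r i < (s i - (y (i - 1) + ε * d (i - 1))) * (y i + ε * d i) := by
    intro i
    have e : (s i - (y (i - 1) + ε * d (i - 1))) * (y i + ε * d i) =
        (s i - y (i - 1)) * y i + ε * (((s i - y (i - 1)) * d i - y i * d (i - 1))
          - ε * (d i * d (i - 1))) := by ring
    rw [e, (hy i).2.2, hd i]
    have := mul_pos hε (sub_pos.2 (h3 i))
    linarith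
  exact ⟨fun i => y i + ε * d i, fun i => ⟨h1 i, by linarith [h2 i], (key i).le⟩, key⟩

theorem exists_two_cyclicSolutions {n : ℕ} {s r : Fin (n + 2) → ℝ} (hr : ∀ i, 0 ≤ r i)
    (hne : (cyclicFeasible s r).Nonempty)
    (hxy : ∀ y ∈ cyclicSolutions s r, ∏ i, (s i - y (i - 1)) ≠ ∏ i, y i) :
    ∃ y ∈ cyclicSolutions s r, ∃ z ∈ cyclicSolutions s r, y ≠ z := by
  have hcont : ContinuousOn (fun y : Fin (n + 2) → ℝ => ∑ i, y i) (cyclicFeasible s r) := by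
    fun_prop
  obtain ⟨y, hy, hymin⟩ := (isCompact_cyclicFeasible s r).exists_isMinOn hne hcont
  obtain ⟨z, hz, hzmax⟩ := (isCompact_cyclicFeasible s r).exists_isMaxOn hne hcont
  have hys := mem_cyclicSolutions_of_isMinOn hr hy hymin
  refine ⟨y, hys, z, mem_cyclicSolutions_of_isMaxOn hr hz hzmax, ?_⟩
  rintro rfl
  -- If minimum and maximum agree, every feasible point is a minimizer, hence a solution, even the
  -- strictly feasible `w`.
  obtain ⟨w, hw, hlt⟩ := exists_cyclicFeasible_strict hys (hxy y hys)
  have hws := mem_cyclicSolutions_of_isMinOn hr hw fun v hv => (hzmax hw).trans (hymin hv)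
  exact (hlt 0).ne' (hws 0).2.2

theorem cyclicSolutions_eq_or_eq {n : ℕ} {s r y z w : Fin (n + 1) → ℝ}
    (hxy : ∀ y ∈ cyclicSolutions s r, ∏ i, (s i - y (i - 1)) ≠ ∏ i, y i)
    (hy : y ∈ cyclicSolutions s r) (hz : z ∈ cyclicSolutions s r) (hyz : y ≠ z)
    (hw : w ∈ cyclicSolutions s r) : w = y ∨ w = z := by
  have step : ∀ v ∈ cyclicSolutions s r, ∀ i,
      (s i - y (i - 1)) * (v - y) i = v i * (v - y) (i - 1) := by
    intro v hv i
    have h1 := (hy i).2.2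
    have h2 := (hv i).2.2
    simp only [Pi.sub_apply]
    linear_combination h2 - h1
  have alt : ∀ v ∈ cyclicSolutions s r, v - y = 0 ∨ ∀ i, (v - y) i ≠ 0 := by
    intro v hv
    refine cyclic_eq_zero_or_forall_ne_zero (step v hv) fun i hi hx j hj => hxy v hv ?_
    rw [Finset.prod_eq_zero (Finset.mem_univ j) hj, Finset.prod_eq_zero (Finset.mem_univ i)]
    simp only [Pi.sub_apply] at hi
    linarith
  have lin : ∀ v ∈ cyclicSolutions s r, (∀ i, (v - y) i ≠ 0) → ∀ i,
      (s i - y (i - 1)) * ((v - y) (i - 1))⁻¹ = y i * ((v - y) i)⁻¹ + 1 := by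
    intro v hv hne i
    have h := step v hv i
    have h1 := hne i
    have h2 := hne (i - 1)
    have h3 : v i = y i + (v - y) i := by simp
    rw [h3] at h
    field_simp
    linear_combination h
  rcases alt w hw with h | h
  · exact Or.inl (sub_eq_zero.1 h)
  have hz' := (alt z hz).resolve_left fun h => hyz (sub_eq_zero.1 h).symm
  right
  -- Both inverse differences solve the affine system `lin`, so their difference solves the
  -- homogeneous one.
  have h0 : (fun i => ((w - y) i)⁻¹ - ((z - y) i)⁻¹) = 0 := by
    refine cyclic_eq_zero (hxy y hy).symm fun i => ?_
    linear_combination lin z hz hz' i - lin w hw h i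
  funext i
  have := congrFun h0 i
  simpa [sub_eq_zero] using this

theorem exists_sq_eq_sq_eq_mul_eq {x y t : ℝ} (hx : 0 ≤ x) (hy : 0 ≤ y) (h : x * y = t ^ 2) :
    ∃ a b : ℝ, a ^ 2 = x ∧ b ^ 2 = y ∧ a * b = t := by
  rcases hx.eq_or_lt with rfl | hx
  · refine ⟨0, √y, by simp, Real.sq_sqrt hy, ?_⟩
    have : t = 0 := by simpa using h.symm
    simp [this]
  · have hs := Real.sqrt_pos.2 hx
    refine ⟨√x, t / √x, Real.sq_sqrt hx.le, ?_, mul_div_cancel₀ _ hs.ne'⟩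
    rw [div_pow, Real.sq_sqrt hx.le, ← h, mul_div_cancel_left₀ _ hx.ne']

/-! ### Cyclic matrices and their determinants -/

/-- The edge-vertex matrix of the cycle, with weight `a k` at the start and `b k` at the end
of the `k`-th edge. -/
def cyclicBidiagonal {n : ℕ} (a b : Fin (n + 1) → ℝ) : Matrix (Fin (n + 1)) (Fin (n + 1)) ℝ :=
  Matrix.of fun i k => (if i = k then a k else 0) + (if i = k + 1 then b k else 0)

/-- The periodic symmetric tridiagonal matrix with diagonal `s` and off-diagonal `t`. -/
def cyclicTridiagonal {n : ℕ} (s t : Fin (n + 1) → ℝ) : Matrix (Fin (n + 1)) (Fin (n + 1)) ℝ :=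
  Matrix.of fun i j =>
    (if i = j then s i else 0) + (if j = i + 1 then t i else 0) + (if i = j + 1 then t j else 0)

theorem cyclicBidiagonal_mul_transpose {n : ℕ} (a b : Fin (n + 1) → ℝ) :
    cyclicBidiagonal a b * (cyclicBidiagonal a b).transpose =
      cyclicTridiagonal (fun i => a i ^ 2 + b (i - 1) ^ 2) (fun i => a i * b i) := by
  ext i j
  have h : ∀ i k : Fin (n + 1), (i = k + 1) = (i - 1 = k) := fun i k => by
    rw [sub_eq_iff_eq_add]
  simp only [Matrix.mul_apply, Matrix.transpose_apply, cyclicBidiagonal, cyclicTridiagonal,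
    Matrix.of_apply, h, add_mul, mul_add, Finset.sum_add_distrib, ite_mul, zero_mul,
    Finset.sum_ite_eq, Finset.mem_univ, if_true, mul_ite, mul_zero]
  have h' : (i - 1 = j - 1) = (i = j) := by rw [sub_left_inj]
  simp only [h', eq_comm (a := j - 1) (b := i)]
  rcases eq_or_ne i j with rfl | hij
  · generalize i - 1 = p
    by_cases hp : i = p
    · subst hp; simp; ring
    · simp [hp, Ne.symm hp]; ring
  · generalize i - 1 = p
    generalize j - 1 = q
    by_cases hp : p = j <;> by_cases hq : i = q
    · subst hp hq; simp [hij]; try ring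
    · subst hp; simp [hij, hq]; try ring
    · subst hq; simp [hij, hp]; try ring
    · simp [hij, hp, hq]

theorem Fin.add_one_add_one_ne_self {n : ℕ} (k : Fin (n + 3)) : k + 1 + 1 ≠ k := by
  intro e
  rw [add_assoc, add_eq_left] at e
  simp [Fin.ext_iff, Fin.val_add, Nat.mod_eq_of_lt (show 2 < n + 3 by omega)] at e

theorem cyclicTridiagonal_inj {n : ℕ} {s t s' t' : Fin (n + 3) → ℝ} :
    cyclicTridiagonal s t = cyclicTridiagonal s' t' ↔ s = s' ∧ t = t' := by
  refine ⟨fun h => ⟨funext fun i => ?_, funext fun i => ?_⟩, fun ⟨h, h'⟩ => h ▸ h' ▸ rfl⟩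
  · simpa [cyclicTridiagonal] using congrFun (congrFun h i) i
  · have h2 := (Fin.add_one_add_one_ne_self i).symm
    simpa [cyclicTridiagonal, h2] using congrFun (congrFun h i) (i + 1)

/-- Only the identity and the rotation contribute to the Leibniz sum: once a permutation shifts one
index, injectivity makes it shift the next. Only `ε ^ 2 = 1` matters later. -/
theorem exists_det_cyclicBidiagonal (n : ℕ) : ∃ ε : ℝ, ε ^ 2 = 1 ∧
    ∀ a b : Fin (n + 3) → ℝ, (cyclicBidiagonal a b).det = ∏ i, a i + ε * ∏ i, b i := by
  let ρ : Equiv.Perm (Fin (n + 3)) := Equiv.addRight 1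
  refine ⟨((Equiv.Perm.sign ρ : ℤˣ) : ℤ), ?_, fun a b => ?_⟩
  · rcases Int.units_eq_one_or (Equiv.Perm.sign ρ) with h | h <;> simp [h]
  have hρ : (1 : Equiv.Perm (Fin (n + 3))) ≠ ρ := by
    intro h
    have := congrArg (fun σ : Equiv.Perm (Fin (n + 3)) => σ 0) h
    simp [ρ] at this
  have e1 : ∀ k : Fin (n + 3), cyclicBidiagonal a b k k = a k := fun k => by
    simp [cyclicBidiagonal]
  have e2 : ∀ k : Fin (n + 3), cyclicBidiagonal a b (k + 1) k = b k := fun k => by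
    simp [cyclicBidiagonal]
  rw [Matrix.det_apply', Finset.sum_eq_add (1 : Equiv.Perm (Fin (n + 3))) ρ hρ]
  · simp [ρ, e1, e2]
  · rintro σ - ⟨h1, h2⟩
    refine mul_eq_zero_of_right _ ?_
    by_contra hne
    rw [← ne_eq, Finset.prod_ne_zero_iff] at hne
    have hσ : ∀ k, σ k = k ∨ σ k = k + 1 := by
      intro k
      by_contra! hk
      exact hne k (Finset.mem_univ k) (by simp [cyclicBidiagonal, hk.1, hk.2])
    have hup : ∀ k, σ k = k + 1 → σ (k + 1) = k + 1 + 1 := fun k hk =>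
      (hσ (k + 1)).resolve_left fun h => by
        have := σ.injective (h.trans hk.symm)
        simp at this
    by_cases hex : ∃ k, σ k = k + 1
    · obtain ⟨k, hk⟩ := hex
      exact h2 (Equiv.ext fun j => Fin.cyclic_induction (P := fun k => σ k = k + 1) hup hk j)
    · push Not at hex
      exact h1 (Equiv.ext fun j => (hσ j).resolve_right (hex j))
  · simp
  · simp

/-- Negating `b 0` flips `t 0` and `∏ b` but keeps the diagonal, so the factors are `(∏ a + ε ∏ b)²`
and `(∏ a - ε ∏ b)²`. -/
theorem det_cyclicTridiagonal_mul_det {n : ℕ} (a b : Fin (n + 3) → ℝ) :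
    (cyclicTridiagonal (fun i => a i ^ 2 + b (i - 1) ^ 2) (fun i => a i * b i)).det *
      (cyclicTridiagonal (fun i => a i ^ 2 + b (i - 1) ^ 2)
        (fun i => if i = 0 then -(a i * b i) else a i * b i)).det =
      (∏ i, a i ^ 2 - ∏ i, b i ^ 2) ^ 2 := by
  obtain ⟨ε, hε, hdet⟩ := exists_det_cyclicBidiagonal n
  set b' : Fin (n + 3) → ℝ := fun i => (if i = 0 then -1 else 1) * b i with hb'
  have h1 : cyclicTridiagonal (fun i => a i ^ 2 + b (i - 1) ^ 2)
      (fun i => if i = 0 then -(a i * b i) else a i * b i) =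
      cyclicBidiagonal a b' * (cyclicBidiagonal a b').transpose := by
    rw [cyclicBidiagonal_mul_transpose, cyclicTridiagonal_inj]
    refine ⟨funext fun i => ?_, funext fun i => ?_⟩
    · simp only [hb']; split_ifs <;> ring
    · simp only [hb']; split_ifs <;> ring
  have h2 : ∏ i, b' i = - ∏ i, b i := by
    simp only [hb', Finset.prod_mul_distrib, Finset.prod_ite_eq', Finset.mem_univ, if_true,
      neg_one_mul]
  rw [h1, ← cyclicBidiagonal_mul_transpose, Matrix.det_mul, Matrix.det_mul, Matrix.det_transpose,
    Matrix.det_transpose, hdet, hdet, h2, Finset.prod_pow, Finset.prod_pow]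
  linear_combination (-2 * (∏ i, a i) ^ 2 * (∏ i, b i) ^ 2
    + (∏ i, b i) ^ 4 * (ε ^ 2 + 1)) * hε

/-! ### Faces of the cycle and edge coordinates -/

/-- The `k`-th edge of the cycle. -/
def cycleEdge {n : ℕ} (k : Fin (n + 3)) : Finset (Fin (n + 3)) := {k, k + 1}

theorem cycleEdge_injective {n : ℕ} :
    Function.Injective (cycleEdge : Fin (n + 3) → Finset (Fin (n + 3))) := by
  intro k l h
  have h1 : k ∈ cycleEdge l := h ▸ Finset.mem_insert_self _ _
  have h2 : k + 1 ∈ cycleEdge l := h ▸ by simp [cycleEdge]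
  simp only [cycleEdge, Finset.mem_insert, Finset.mem_singleton] at h1 h2
  rcases h1 with h1 | rfl
  · exact h1
  · rcases h2 with h2 | h2
    · exact absurd h2 (Fin.add_one_add_one_ne_self l)
    · exact add_right_cancel h2

theorem card_cycleEdge {n : ℕ} (k : Fin (n + 3)) : (cycleEdge k).card = 2 :=
  Finset.card_pair (by simp)

theorem mem_cycleComplex {n : ℕ} {F : Finset (Fin (n + 3))} :
    F ∈ cycleComplex (n + 3) ↔ F = ∅ ∨ (∃ i, F = {i}) ∨ ∃ k, F = cycleEdge k := by
  simp only [cycleComplex, edgeComplex, Finset.mem_filter, Finset.mem_univ, true_and,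
    Finset.card_le_one_iff_subset_singleton, Finset.subset_singleton_iff,
    SimpleGraph.cycleGraph_adj, cycleEdge]
  constructor
  · rintro (⟨i, h | h⟩ | ⟨i, j, h | h, rfl⟩)
    · exact Or.inl h
    · exact Or.inr (Or.inl ⟨i, h⟩)
    · refine Or.inr (Or.inr ⟨j, ?_⟩)
      rw [← h, add_sub_cancel, Finset.pair_comm]
    · refine Or.inr (Or.inr ⟨i, ?_⟩)
      rw [← h, add_sub_cancel]
  · rintro (h | ⟨i, h⟩ | ⟨k, h⟩)
    · exact Or.inl ⟨0, Or.inl h⟩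
    · exact Or.inl ⟨i, Or.inr h⟩
    · exact Or.inr ⟨k, k + 1, by simp, h⟩

theorem cycleEdge_mem_cycleComplex {n : ℕ} (k : Fin (n + 3)) :
    cycleEdge k ∈ cycleComplex (n + 3) :=
  mem_cycleComplex.2 (Or.inr (Or.inr ⟨k, rfl⟩))

/-- The faces of the cycle: the empty face, the vertices and the edges. -/
def cycleFace {n : ℕ} : Unit ⊕ (Fin (n + 3) ⊕ Fin (n + 3)) →
    {F : Finset (Fin (n + 3)) // F ∈ cycleComplex (n + 3)}
  | Sum.inl _ => ⟨∅, mem_cycleComplex.2 (Or.inl rfl)⟩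
  | Sum.inr (Sum.inl i) => ⟨{i}, singleton_mem_cycleComplex i⟩
  | Sum.inr (Sum.inr k) => ⟨cycleEdge k, cycleEdge_mem_cycleComplex k⟩

theorem cycleFace_bijective {n : ℕ} : Function.Bijective (cycleFace (n := n)) := by
  constructor
  · rintro (_ | i | k) (_ | j | l) h <;>
      have h' := congrArg Subtype.val h <;>
      have hc := congrArg Finset.card h' <;>
      simp only [cycleFace, card_cycleEdge, Finset.card_empty, Finset.card_singleton] at h' hc <;>
      try omega
    · rfl
    · rw [Finset.singleton_inj.1 h']
    · rw [cycleEdge_injective h']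
  · rintro ⟨F, hF⟩
    rcases mem_cycleComplex.1 hF with rfl | ⟨i, rfl⟩ | ⟨k, rfl⟩
    · exact ⟨Sum.inl (), rfl⟩
    · exact ⟨Sum.inr (Sum.inl i), rfl⟩
    · exact ⟨Sum.inr (Sum.inr k), rfl⟩

/-- The coordinates `γ_{i,{i}}`. -/
def vertexWeight {n : ℕ} (γ : FaceParams (cycleComplex (n + 3))) (i : Fin (n + 3)) : ℝ :=
  γ ⟨{i}, singleton_mem_cycleComplex i⟩ ⟨i, Finset.mem_singleton_self i⟩

/-- The coordinates `γ_{k,{k,k+1}}`. -/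
def startWeight {n : ℕ} (γ : FaceParams (cycleComplex (n + 3))) (k : Fin (n + 3)) : ℝ :=
  γ ⟨cycleEdge k, cycleEdge_mem_cycleComplex k⟩ ⟨k, Finset.mem_insert_self _ _⟩

/-- The coordinates `γ_{k+1,{k,k+1}}`. -/
def endWeight {n : ℕ} (γ : FaceParams (cycleComplex (n + 3))) (k : Fin (n + 3)) : ℝ :=
  γ ⟨cycleEdge k, cycleEdge_mem_cycleComplex k⟩
    ⟨k + 1, Finset.mem_insert_of_mem (Finset.mem_singleton_self _)⟩

theorem forall_weights {n : ℕ} {P : ℝ → ℝ → Prop} {γ γ' : FaceParams (cycleComplex (n + 3))}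
    (hv : ∀ i, P (vertexWeight γ i) (vertexWeight γ' i))
    (hs : ∀ k, P (startWeight γ k) (startWeight γ' k))
    (he : ∀ k, P (endWeight γ k) (endWeight γ' k)) : ∀ F i, P (γ F i) (γ' F i) := by
  rintro ⟨F, hF⟩ ⟨i, hi⟩
  rcases mem_cycleComplex.1 hF with rfl | ⟨j, rfl⟩ | ⟨k, rfl⟩
  · simp at hi
  · obtain rfl := Finset.mem_singleton.1 hi
    exact hv i
  · rcases Finset.mem_insert.1 hi with rfl | h
    · exact hs i
    · obtain rfl := Finset.mem_singleton.1 h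
      exact he k

/-- The parameter with vanishing vertex coordinates and prescribed edge coordinates. -/
def ofWeights {n : ℕ} (a b : Fin (n + 3) → ℝ) : FaceParams (cycleComplex (n + 3)) :=
  fun F i => if F.1 = cycleEdge i.1 then a i.1
    else if F.1 = cycleEdge (i.1 - 1) then b (i.1 - 1) else 0

theorem singleton_ne_cycleEdge {n : ℕ} (i k : Fin (n + 3)) : {i} ≠ cycleEdge k := by
  intro h
  have := congrArg Finset.card h
  simp [card_cycleEdge] at this

@[simp] theorem vertexWeight_ofWeights {n : ℕ} (a b : Fin (n + 3) → ℝ) :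
    vertexWeight (ofWeights a b) = 0 := by
  ext i
  simp [vertexWeight, ofWeights, singleton_ne_cycleEdge]

@[simp] theorem startWeight_ofWeights {n : ℕ} (a b : Fin (n + 3) → ℝ) :
    startWeight (ofWeights a b) = a := by
  ext k
  simp [startWeight, ofWeights]

@[simp] theorem endWeight_ofWeights {n : ℕ} (a b : Fin (n + 3) → ℝ) :
    endWeight (ofWeights a b) = b := by
  ext k
  simp [endWeight, ofWeights, cycleEdge_injective.eq_iff]

theorem phi_cycleComplex {n : ℕ} (γ : FaceParams (cycleComplex (n + 3))) :
    phi (cycleComplex (n + 3)) γ = cyclicTridiagonal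
      (fun i => startWeight γ i ^ 2 + endWeight γ (i - 1) ^ 2 + vertexWeight γ i ^ 2)
      (fun i => startWeight γ i * endWeight γ i) := by
  have h0 : ∀ i, gammaMatrix _ γ i (cycleFace (Sum.inl ())) = 0 := fun i => by
    simp [gammaMatrix, cycleFace]
  have h1 : ∀ i k, gammaMatrix _ γ i (cycleFace (Sum.inr (Sum.inl k))) =
      if i = k then vertexWeight γ k else 0 := fun i k => by
    rcases eq_or_ne i k with rfl | h
    · simp [gammaMatrix, cycleFace, vertexWeight]
    · simp [gammaMatrix, cycleFace, h]
  have h2 : ∀ i k, gammaMatrix _ γ i (cycleFace (Sum.inr (Sum.inr k))) =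
      cyclicBidiagonal (startWeight γ) (endWeight γ) i k := fun i k => by
    rcases eq_or_ne i k with rfl | h
    · simp [gammaMatrix, cycleFace, startWeight, cyclicBidiagonal, cycleEdge]
    · rcases eq_or_ne i (k + 1) with rfl | h'
      · simp [gammaMatrix, cycleFace, endWeight, cyclicBidiagonal, cycleEdge]
      · simp [gammaMatrix, cycleFace, cyclicBidiagonal, cycleEdge, h, h']
  ext i j
  have h3 := congrFun (congrFun
    (cyclicBidiagonal_mul_transpose (startWeight γ) (endWeight γ)) i) j
  simp only [Matrix.mul_apply, Matrix.transpose_apply] at h3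
  rw [phi, Matrix.mul_apply, ← cycleFace_bijective.sum_comp, Fintype.sum_sum_type,
    Fintype.sum_sum_type]
  simp only [Matrix.transpose_apply, Finset.univ_unique, PUnit.default_eq_unit,
    Finset.sum_singleton, h0, h1, h2, h3]
  rcases eq_or_ne i j with rfl | h
  · simp [cyclicTridiagonal]
    ring
  · simp [cyclicTridiagonal, h]

theorem mem_cycleFiber_iff {n : ℕ} {s t : Fin (n + 3) → ℝ}
    {γ : FaceParams (cycleComplex (n + 3))} :
    γ ∈ cycleFiber (cyclicTridiagonal s t) ↔ (∀ i, vertexWeight γ i = 0) ∧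
      (∀ i, startWeight γ i ^ 2 + endWeight γ (i - 1) ^ 2 = s i) ∧
      ∀ i, startWeight γ i * endWeight γ i = t i := by
  simp only [cycleFiber, Set.mem_ofPred_eq, phi_cycleComplex, cyclicTridiagonal_inj, funext_iff]
  change _ ∧ (∀ i, vertexWeight γ i = 0) ↔ _
  constructor
  · rintro ⟨⟨h1, h2⟩, h0⟩
    exact ⟨h0, fun i => by simpa [h0] using h1 i, h2⟩
  · rintro ⟨h0, h1, h2⟩
    exact ⟨⟨fun i => by simpa [h0] using h1 i, h2⟩, h0⟩

theorem negateEntry_cyclicTridiagonal {n : ℕ} (s t : Fin (n + 3) → ℝ) :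
    negateEntry (cyclicTridiagonal s t) 0 1 =
      cyclicTridiagonal s (fun i => if i = 0 then -t i else t i) := by
  have h2 : (1 : Fin (n + 3)) + 1 ≠ 0 := by
    simpa using Fin.add_one_add_one_ne_self (0 : Fin (n + 3))
  ext i j
  simp only [negateEntry, cyclicTridiagonal, Matrix.of_apply]
  rcases eq_or_ne i 0 with rfl | hi
  · rcases eq_or_ne j 1 with rfl | hj
    · simp [h2.symm]
    · by_cases hj0 : j = 0
      · simp [hj0]
      · simp [hj, hj0]
  · rcases eq_or_ne j 0 with rfl | hj
    · rcases eq_or_ne i 1 with rfl | hi1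
      · simp [h2.symm]
      · simp [hi, hi1]
    · simp [hi, hj]

/-! ### Signs and the count of the fiber -/

theorem exists_sign_of_sq_eq {a b A B : ℝ} (ha : a ^ 2 = A ^ 2) (hb : b ^ 2 = B ^ 2)
    (h : a * b = A * B) : ∃ ε : ℤˣ, a = ((ε : ℤ) : ℝ) * A ∧ b = ((ε : ℤ) : ℝ) * B := by
  have pos : a = A → b = B → ∃ ε : ℤˣ, a = ((ε : ℤ) : ℝ) * A ∧ b = ((ε : ℤ) : ℝ) * B :=
    fun h1 h2 => ⟨1, by simp [h1], by simp [h2]⟩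
  have neg : a = -A → b = -B → ∃ ε : ℤˣ, a = ((ε : ℤ) : ℝ) * A ∧ b = ((ε : ℤ) : ℝ) * B :=
    fun h1 h2 => ⟨-1, by simp [h1], by simp [h2]⟩
  rcases sq_eq_sq_iff_eq_or_eq_neg.1 ha with h1 | h1 <;>
    rcases sq_eq_sq_iff_eq_or_eq_neg.1 hb with h2 | h2
  · exact pos h1 h2
  · have h3 : A * B = 0 := by rw [h1, h2] at h; linarith
    rcases mul_eq_zero.1 h3 with h3 | h3
    · exact neg (by rw [h1, h3, neg_zero]) h2
    · exact pos h1 (by rw [h2, h3, neg_zero])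
  · have h3 : A * B = 0 := by rw [h1, h2] at h; linarith
    rcases mul_eq_zero.1 h3 with h3 | h3
    · exact pos (by rw [h1, h3, neg_zero]) h2
    · exact neg h1 (by rw [h2, h3, neg_zero])
  · exact neg h1 h2

theorem Int.cast_units_sq (ε : ℤˣ) : ((ε : ℤ) : ℝ) ^ 2 = 1 := by
  rcases Int.units_eq_one_or ε with h | h <;> simp [h]

theorem mainTheorem7 (m : ℕ) (hm : 3 ≤ m) (S : Matrix (Fin m) (Fin m) ℝ)
    (hpos : S.PosDef) (himage : S ∈ Set.range (phi (cycleComplex m)))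
    (hnonsing : (negateEntry S ⟨0, by omega⟩ ⟨1, by omega⟩).det ≠ 0) :
    (cycleFiber S).ncard = 2 ^ (m + 1) ∧
      ∃ γ₁ ∈ cycleFiber S, ∃ γ₂ ∈ cycleFiber S, ¬ EqUpToSign γ₁ γ₂ ∧
        ∀ γ ∈ cycleFiber S, EqUpToSign γ γ₁ ∨ EqUpToSign γ γ₂ := by
  obtain ⟨n, rfl⟩ : ∃ n, m = n + 3 := ⟨m - 3, by omega⟩
  obtain ⟨γ₀, rfl⟩ := himage
  replace hnonsing : (negateEntry (phi (cycleComplex (n + 3)) γ₀) 0 1).det ≠ 0 := hnonsing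
  replace hpos := hpos.det_pos.ne'
  rw [phi_cycleComplex] at hpos hnonsing ⊢
  rw [negateEntry_cyclicTridiagonal] at hnonsing
  set s : Fin (n + 3) → ℝ := fun i =>
    startWeight γ₀ i ^ 2 + endWeight γ₀ (i - 1) ^ 2 + vertexWeight γ₀ i ^ 2 with hs
  set t : Fin (n + 3) → ℝ := fun i => startWeight γ₀ i * endWeight γ₀ i with ht
  set r : Fin (n + 3) → ℝ := fun i => t i ^ 2 with hr
  have lift : ∀ y ∈ cyclicSolutions s r, ∀ k, ∃ a b : ℝ,
      a ^ 2 = s k - y (k - 1) ∧ b ^ 2 = y k ∧ a * b = t k := fun y hy k =>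
    exists_sq_eq_sq_eq_mul_eq (sub_nonneg.2 (hy k).2.1) (hy k).1 (hy k).2.2
  have hxy : ∀ y ∈ cyclicSolutions s r, ∏ i, (s i - y (i - 1)) ≠ ∏ i, y i := by
    intro y hy heq
    choose a b ha hb hab using lift y hy
    have h := det_cyclicTridiagonal_mul_det a b
    have h1 : ∀ i, a i ^ 2 + b (i - 1) ^ 2 = s i := fun i => by rw [ha, hb, sub_add_cancel]
    have h2 : (∏ i, a i ^ 2) = ∏ i, b i ^ 2 := by simpa only [ha, hb] using heq
    simp only [h1, hab] at h
    rw [h2, sub_self, zero_pow two_ne_zero] at h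
    exact (mul_ne_zero hpos hnonsing) h
  have hne : (cyclicFeasible s r).Nonempty := by
    -- The given preimage may have nonzero vertex coordinates; their squares are the slack in the
    -- inequalities.
    refine ⟨fun i => endWeight γ₀ i ^ 2, fun i => ⟨sq_nonneg _, ?_, ?_⟩⟩
    · simp only [hs]
      linarith [sq_nonneg (startWeight γ₀ i), sq_nonneg (vertexWeight γ₀ i)]
    · simp only [hr, ht, hs, mul_pow]
      exact mul_le_mul_of_nonneg_right (by linarith [sq_nonneg (vertexWeight γ₀ i)])
        (sq_nonneg _)
  obtain ⟨y, hy, z, hz, hyz⟩ := exists_two_cyclicSolutions (fun i => sq_nonneg (t i)) hne hxy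
  let Y : Bool → Fin (n + 3) → ℝ := fun c => cond c y z
  have hY : ∀ c, Y c ∈ cyclicSolutions s r := fun c => by cases c <;> assumption
  have hYinj : Function.Injective Y := by
    rintro (_ | _) (_ | _) h
    · rfl
    · exact absurd h.symm hyz
    · exact absurd h hyz
    · rfl
  choose A B hA hB hAB using fun c => lift (Y c) (hY c)
  let Φ : Bool × (Fin (n + 3) → ℤˣ) → FaceParams (cycleComplex (n + 3)) := fun p =>
    ofWeights (fun k => ((p.2 k : ℤ) : ℝ) * A p.1 k) (fun k => ((p.2 k : ℤ) : ℝ) * B p.1 k)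
  have hΦinj : Function.Injective Φ := by
    rintro ⟨c, ε⟩ ⟨c', ε'⟩ h
    have ha := congrArg startWeight h
    have hb := congrArg endWeight h
    simp only [Φ, startWeight_ofWeights, endWeight_ofWeights, funext_iff] at ha hb
    obtain rfl : c = c' := hYinj <| funext fun k => by
      have := congrArg (· ^ 2) (hb k)
      simpa only [mul_pow, Int.cast_units_sq, one_mul, hB] using this
    refine Prod.ext rfl (funext fun k => Units.ext ?_)
    -- Differing signs would force `A c k = B c k = 0`, so both products vanish, against `hxy`.
    by_contra hk
    have hk' : ((ε k : ℤ) : ℝ) ≠ ((ε' k : ℤ) : ℝ) := by exact_mod_cast hk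
    have hA0 : A c k = 0 := by_contra fun h => hk' (mul_right_cancel₀ h (ha k))
    have hB0 : B c k = 0 := by_contra fun h => hk' (mul_right_cancel₀ h (hb k))
    refine hxy _ (hY c) ?_
    rw [Finset.prod_eq_zero (Finset.mem_univ k) (by rw [← hA, hA0, zero_pow two_ne_zero]),
      Finset.prod_eq_zero (Finset.mem_univ k) (by rw [← hB, hB0, zero_pow two_ne_zero])]
  have hmem : ∀ p, Φ p ∈ cycleFiber (cyclicTridiagonal s t) := by
    intro p
    rw [mem_cycleFiber_iff]
    simp only [Φ, vertexWeight_ofWeights, startWeight_ofWeights, endWeight_ofWeights, mul_pow,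
      Int.cast_units_sq, one_mul, hA, hB, sub_add_cancel, Pi.zero_apply, implies_true, true_and]
    intro i
    linear_combination A p.1 i * B p.1 i * Int.cast_units_sq (p.2 i) + hAB p.1 i
  have hsurj : ∀ γ ∈ cycleFiber (cyclicTridiagonal s t), ∃ p, Φ p = γ := by
    intro γ hγ
    obtain ⟨h0, h1, h2⟩ := mem_cycleFiber_iff.1 hγ
    have hx : ∀ i, s i - endWeight γ (i - 1) ^ 2 = startWeight γ i ^ 2 := fun i => by
      rw [← h1, add_sub_cancel_right]
    have hw : (fun i => endWeight γ i ^ 2) ∈ cyclicSolutions s r := fun i =>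
      ⟨sq_nonneg _, sub_nonneg.1 (by rw [hx]; exact sq_nonneg _), by
        simp only [hx, hr, ← h2, mul_pow]⟩
    obtain ⟨c, hc⟩ : ∃ c, (fun i => endWeight γ i ^ 2) = Y c := by
      rcases cyclicSolutions_eq_or_eq hxy hy hz hyz hw with h | h
      · exact ⟨true, h⟩
      · exact ⟨false, h⟩
    have hb : ∀ i, endWeight γ i ^ 2 = B c i ^ 2 := fun i => by
      rw [hB]; exact congrFun hc i
    choose ε hεa hεb using fun k => exists_sign_of_sq_eq
      (show startWeight γ k ^ 2 = A c k ^ 2 by rw [hA, ← hx, hb, hB]) (hb k)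
      ((h2 k).trans (hAB c k).symm)
    refine ⟨(c, ε), funext fun F => funext fun i =>
      forall_weights (P := Eq) (fun i => ?_) (fun k => ?_) (fun k => ?_) F i⟩
    · simp [Φ, h0]
    · simp [Φ, hεa]
    · simp [Φ, hεb]
  have hrange : cycleFiber (cyclicTridiagonal s t) = Set.range Φ :=
    Set.Subset.antisymm hsurj (Set.range_subset_iff.2 hmem)
  have hsign : ∀ c ε, EqUpToSign (Φ (c, ε)) (Φ (c, 1)) := by
    intro c ε
    refine forall_weights (P := fun u v => u = v ∨ u = -v) (fun i => ?_) (fun k => ?_)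
      (fun k => ?_)
    · simp [Φ]
    · rcases Int.units_eq_one_or (ε k) with h | h <;> simp [Φ, h]
    · rcases Int.units_eq_one_or (ε k) with h | h <;> simp [Φ, h]
  refine ⟨?_, Φ (true, 1), hmem _, Φ (false, 1), hmem _, ?_, ?_⟩
  · rw [hrange, ← Set.image_univ, Set.ncard_image_of_injective _ hΦinj, Set.ncard_univ]
    simp [Nat.card_eq_fintype_card, pow_succ]
    ring
  · intro h
    refine absurd (@hYinj true false (funext fun k => ?_)) (by simp)
    have h' : endWeight (Φ (true, 1)) k = endWeight (Φ (false, 1)) k ∨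
        endWeight (Φ (true, 1)) k = -endWeight (Φ (false, 1)) k := h _ _
    simp only [Φ, endWeight_ofWeights, Pi.one_apply, Units.val_one, Int.cast_one, one_mul] at h'
    rw [← hB, ← hB]
    exact sq_eq_sq_iff_eq_or_eq_neg.2 h'
  · intro γ hγ
    obtain ⟨⟨c, ε⟩, rfl⟩ := hsurj γ hγ
    cases c
    · exact Or.inr (hsign _ _)
    · exact Or.inl (hsign _ _)
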